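/- Write $\mathbb D$ for the open unit disc in $\mathbb C$, $\mathbb D_*=\mathbb D\setminus\{0\}$, $\mathbb T=\partial\mathbb D$, and $z\bullet w=\sum_{j=1}^n z_jw_j$ for $z,w\in\mathbb C^n$. A convex tube domain in $\mathbb C^n$ is a set of the form $D=\Omega+i\mathbb R^n$ with $\Omega\subset\mathbb R^n$ a (nonempty, open) convex domain. It is taut if every sequence of holomorphic maps $\mathbb D\to D$ has a subsequence that either converges locally uniformly on $\mathbb D$ to a holomorphic map $\mathbb D\to D$ or is compactly divergent (for all compact $K\subset\mathbb D$, $L\subset D$, the images of $K$ eventually do not meet $L$). For a holomorphic map $\varphi:\mathbb D\to D$ let $\varphi^*(\lambda)=\lim_{r\to1^-}\varphi(r\lambda)$, $\lambda\in\mathbb T$, denote the radial limit; for a taut convex tube domain $D$ it exists for almost every $\lambda\in\mathbb T$ with respect to Lebesgue measure on $\mathbb T$. The map $\varphi$ is a complex geodesic for $D$ if it is an isometry with respect to the Poincaré distance $p(\lambda,\mu)=\operatorname{artanh}\left|\frac{\lambda-\mu}{1-\bar\mu\lambda}\right|$ on $\mathbb D$ and the Carathéodory pseudodistance $c_D(z,w)=\sup\{p(f(z),f(w))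 : f:D\to\mathbb D \text{ holomorphic}\}$ on $D$. **Proposition.** Let $D\subset\mathbb C^n$ be a taut convex tube domain and let $\varphi:\mathbb D\to D$ be a holomorphic map. Suppose that there exists a mapping $h:\mathbb C\to\mathbb C^n$ of the form $h(\lambda)=\bar a\lambda^2+b\lambda+a$ with some $a\in\mathbb C^n$, $b\in\mathbb R^n$, such that (i) for almost every $\lambda\in\mathbb T$ (with respect to Lebesgue measure), $\operatorname{Re}\left[\bar\lambda h(\lambda)\bullet(z-\varphi^*(\lambda))\right]<0$ for all $z\in D$; (ii) $\operatorname{Re}\left[h(\lambda)\bullet\frac{\varphi(0)-\varphi(\lambda)}{\lambda}\right]<0$ for every $\lambda\in\mathbb D_*$. Then $\varphi$ is a complex geodesic for $D$. -/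

import Mathlib

open Set Filter Topology MeasureTheory ComplexConjugate

noncomputable section

/-- The tube `Ω + iℝⁿ` in `ℂⁿ` over a set `Ω ⊆ ℝⁿ`. -/
def tubeOver {n : ℕ} (Ω : Set (Fin n → ℝ)) : Set (Fin n → ℂ) :=
  {z | (fun j => (z j).re) ∈ Ω}

/-- A convex tube domain: a tube whose base is a convex domain in `ℝⁿ`. -/
def IsConvexTubeDomain {n : ℕ} (D : Set (Fin n → ℂ)) : Prop :=
  ∃ Ω : Set (Fin n → ℝ), IsOpen Ω ∧ Ω.Nonempty ∧ Convex ℝ Ω ∧ D = tubeOver Ω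

/-- `φ : 𝔻 → D` is holomorphic; only the values of `φ` on the open unit disc matter. -/
def IsHolomorphicDisc {n : ℕ} (D : Set (Fin n → ℂ)) (φ : ℂ → Fin n → ℂ) : Prop :=
  DifferentiableOn ℂ φ (Metric.ball 0 1) ∧ MapsTo φ (Metric.ball 0 1) D

/-- A sequence of maps `𝔻 → D` is compactly divergent if, for all compact `K ⊆ 𝔻` and `L ⊆ D`,
the images of `K` eventually miss `L`. -/
def CompactlyDivergent {n : ℕ} (D : Set (Fin n → ℂ)) (f : ℕ → ℂ → Fin n → ℂ) : Prop :=
  ∀ K ⊆ Metric.ball (0 : ℂ) 1, IsCompact K → ∀ L ⊆ D, IsCompact L →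
    ∀ᶠ k in atTop, Disjoint (f k '' K) L

/-- `D` is taut: the family of holomorphic maps `𝔻 → D` is normal, i.e. every sequence in it has
a subsequence that either converges locally uniformly on `𝔻` to a holomorphic map `𝔻 → D`,
or is compactly divergent. -/
def IsTaut {n : ℕ} (D : Set (Fin n → ℂ)) : Prop :=
  ∀ f : ℕ → ℂ → Fin n → ℂ, (∀ k, IsHolomorphicDisc D (f k)) →
    ∃ σ : ℕ → ℕ, StrictMono σ ∧
      ((∃ g : ℂ → Fin n → ℂ, IsHolomorphicDisc D g ∧
          TendstoLocallyUniformlyOn (fun k => f (σ k)) g atTop (Metric.ball 0 1)) ∨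
        CompactlyDivergent D (fun k => f (σ k)))

/-- The Poincaré distance on the open unit disc. -/
def poincareDist (l m : ℂ) : ℝ :=
  Real.artanh (‖l - m‖ / ‖1 - conj m * l‖)

/-- The Carathéodory pseudodistance of `D`: the supremum of the Poincaré distances of `f z` and
`f w` over all holomorphic `f : D → 𝔻`, taken in `[0, ∞]`. -/
def caratheodoryDist {n : ℕ} (D : Set (Fin n → ℂ)) (z w : Fin n → ℂ) : ENNReal :=
  ⨆ f : {f : (Fin n → ℂ) → ℂ // DifferentiableOn ℂ f D ∧ MapsTo f D (Metric.ball 0 1)},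
    ENNReal.ofReal (poincareDist (f.1 z) (f.1 w))

/-- `φ` is a complex geodesic for `D`: a holomorphic map `𝔻 → D` which is an isometry for the
Poincaré distance in `𝔻` and the Carathéodory pseudodistance in `D`. -/
def IsComplexGeodesic {n : ℕ} (D : Set (Fin n → ℂ)) (φ : ℂ → Fin n → ℂ) : Prop :=
  IsHolomorphicDisc D φ ∧
    ∀ l ∈ Metric.ball (0 : ℂ) 1, ∀ m ∈ Metric.ball (0 : ℂ) 1,
      caratheodoryDist D (φ l) (φ m) = ENNReal.ofReal (poincareDist l m)

/-- Lebesgue (arc length) measure on the unit circle `𝕋`, as a measure on `ℂ` carried by `𝕋`. -/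
def circleLebesgue : Measure ℂ :=
  Measure.map (circleMap 0 1) (volume.restrict (Ioc 0 (2 * Real.pi)))

/-- `w` is the radial limit `φ*(l) = lim_{r → 1⁻} φ(r l)`. -/
def IsRadialLimit {n : ℕ} (φ : ℂ → Fin n → ℂ) (l : ℂ) (w : Fin n → ℂ) : Prop :=
  Tendsto (fun r : ℝ => φ ((r : ℂ) * l)) (𝓝[<] 1) (𝓝 w)

end

/-! A holomorphic left inverse of φ would make φ a geodesic. The natural candidate sends z to a root
λ of h(λ) • (z - φ(λ)) = 0, because z = φ(μ) has the root μ. To get exactly one root for every z ∈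
D, the equation is perturbed to h(λ) • (z - φ(λ)) = ελ with ε > 0.

With α = a • (z - φ(0)) the left side equals α - ᾱλ² + λQ(λ), the Berkson–Porta form
(`quadMap_dotProduct_eq`). Condition (ii) bounds Re Q from above and condition (i) makes its radial
limits nonpositive, so Re Q ≤ 0 (`re_nonpos_of_ae_radial`). The perturbed function E then satisfies
Re(λ̄E(λ)) < 0 on circles close to 𝕋, which forces a single, simple zero f_ε(z)
(`exists_unique_simple_zero`). It depends holomorphically on z by the implicit function theorem, and
f_ε(φ(μ)) → μ as ε → 0 (`tendsto_zero_of_perturbation`). Hence c_D ≥ p along φ in the limit, and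
Schwarz–Pick gives the other inequality.

Radial limits of φ exist because the base of a taut tube contains no line, so the linear functionals
bounded above on it span. Each of them maps φ into a half-plane, where Fatou's theorem applies. -/

/-! ### Fatou's theorem for bounded holomorphic functions -/

lemma Complex.norm_sub_sq_of_norm_eq_one {l ζ : ℂ} (hζ : ‖ζ‖ = 1) :
    ‖l - ζ‖ ^ 2 = 1 + ‖l‖ ^ 2 - 2 * (l * conj ζ).re := by
  have h1 : ζ.re ^ 2 + ζ.im ^ 2 = 1 := by
    have := Complex.sq_norm ζ
    rw [hζ, Complex.normSq_apply] at this
    linarith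
  rw [Complex.sq_norm, Complex.sq_norm, Complex.normSq_apply, Complex.normSq_apply]
  simp only [Complex.sub_re, Complex.sub_im, Complex.mul_re, Complex.conj_re, Complex.conj_im]
  linarith

/-- Maximum principle with a peak function at ζ₀: the factor exp(M(λζ̄₀ - 1)) has modulus at most 1
on the disc and, for large M, suppresses the crude constant C away from ζ₀. A first-order estimate
near ζ₀ on the circle thus passes to the interior. -/
lemma norm_le_of_norm_le_on_circle_near {H : ℂ → ℂ} (hH : DiffContOnCl ℂ H (Metric.ball 0 1))
    {ζ₀ : ℂ} (hζ₀ : ‖ζ₀‖ = 1) {C η δ : ℝ} (hη : 0 < η) (hδ : 0 < δ)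
    (hC : ∀ ζ, ‖ζ‖ = 1 → ‖H ζ‖ ≤ C * ‖ζ - ζ₀‖)
    (hnear : ∀ ζ, ‖ζ‖ = 1 → ‖ζ - ζ₀‖ < δ → ‖H ζ‖ ≤ η * ‖ζ - ζ₀‖) :
    ∃ M : ℝ, ∀ l ∈ Metric.ball (0 : ℂ) 1,
      ‖H l‖ ≤ η * Real.exp (M * (1 - (l * conj ζ₀).re)) * ‖l - ζ₀‖ := by
  -- On the circle 1 - Re(xζ̄₀) = |x - ζ₀|²/2, which is at least δ²/2 outside the δ-neighbourhood of
  -- ζ₀.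
  obtain ⟨M, hM0, hM⟩ : ∃ M : ℝ, 0 ≤ M ∧ C * Real.exp (-(M * (δ ^ 2 / 2))) ≤ η := by
    have ht : Tendsto (fun M : ℝ => C * Real.exp (-(M * (δ ^ 2 / 2)))) atTop (𝓝 (C * 0)) := by
      refine (Real.tendsto_exp_neg_atTop_nhds_zero.comp ?_).const_mul C
      exact tendsto_id.atTop_mul_const (by positivity)
    rw [mul_zero] at ht
    obtain ⟨M, h1, h2⟩ := ((ht.eventually_le_const hη).and (eventually_ge_atTop 0)).exists
    exact ⟨M, h2, h1⟩
  refine ⟨M, fun l hl => ?_⟩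
  have hl1 : ‖l‖ < 1 := by simpa using hl
  have key : ∀ ρ : ℝ, 1 < ρ →
      ‖H l‖ ≤ η * Real.exp (M * (1 - (l * conj ζ₀).re)) * ‖l - ρ * ζ₀‖ := by
    intro ρ hρ
    have hρζ : ‖(ρ : ℂ) * ζ₀‖ = ρ := by simp [hζ₀, abs_of_pos (by linarith : (0:ℝ) < ρ)]
    have hne : ∀ x : ℂ, ‖x‖ ≤ 1 → x - ρ * ζ₀ ≠ 0 := by
      intro x hx h0
      rw [sub_eq_zero] at h0
      rw [h0, hρζ] at hx
      linarith
    -- The pole is moved to ρζ₀ with ρ > 1, so that B is continuous on the closed disc; ρ → 1 at the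
    -- end.
    let B : ℂ → ℂ := fun x => H x * Complex.exp (M * (x * conj ζ₀ - 1)) * (x - ρ * ζ₀)⁻¹
    have hB : DiffContOnCl ℂ B (Metric.ball 0 1) := by
      have hd : Differentiable ℂ (fun x : ℂ => Complex.exp (M * (x * conj ζ₀ - 1))) := by fun_prop
      refine (hH.smul hd.diffContOnCl).smul (DiffContOnCl.inv ?_ ?_)
      · exact Differentiable.diffContOnCl (by fun_prop)
      · intro x hx
        rw [closure_ball _ one_ne_zero] at hx
        exact hne x (by simpa using hx)
    have hnorm : ∀ x, ‖B x‖ = ‖H x‖ * Real.exp (-(M * (1 - (x * conj ζ₀).re))) * ‖x - ρ * ζ₀‖⁻¹ := by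
      intro x
      simp only [B, norm_mul, norm_inv, Complex.norm_exp]
      congr 3
      simp
      ring
    have hbd : ∀ x ∈ frontier (Metric.ball (0 : ℂ) 1), ‖B x‖ ≤ η := by
      intro x hx
      rw [frontier_ball _ one_ne_zero] at hx
      have hx1 : ‖x‖ = 1 := by simpa using hx
      have hsq := Complex.norm_sub_sq_of_norm_eq_one (l := x) hζ₀
      rw [hx1] at hsq
      have hpos : 0 < ‖x - ρ * ζ₀‖ := norm_pos_iff.2 (hne x hx1.le)
      have hle : ‖x - ζ₀‖ ≤ ‖x - ρ * ζ₀‖ := by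
        have hsq2 : ‖x - ρ * ζ₀‖ ^ 2 = ‖x - ζ₀‖ ^ 2 + ρ ^ 2 - 1 - 2 * (ρ - 1) * (x * conj ζ₀).re := by
          have h1 : ζ₀.re ^ 2 + ζ₀.im ^ 2 = 1 := by
            have := Complex.sq_norm ζ₀
            rw [hζ₀, Complex.normSq_apply] at this
            linarith
          rw [Complex.sq_norm, Complex.sq_norm, Complex.normSq_apply, Complex.normSq_apply]
          simp
          linear_combination (ρ ^ 2 - 1) * h1
        have hre : (x * conj ζ₀).re ≤ 1 := by
          refine (Complex.re_le_norm _).trans ?_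
          simp [hx1, hζ₀]
        refine abs_le_of_sq_le_sq' ?_ hpos.le |>.2
        nlinarith
      rw [hnorm, mul_inv_le_iff₀ hpos]
      refine le_trans ?_ (mul_le_mul_of_nonneg_left hle hη.le)
      have hexp : Real.exp (-(M * (1 - (x * conj ζ₀).re))) ≤ 1 := by
        rw [Real.exp_le_one_iff]
        have : 0 ≤ 1 - (x * conj ζ₀).re := by nlinarith [sq_nonneg ‖x - ζ₀‖]
        have := mul_nonneg hM0 this
        linarith
      by_cases hxd : ‖x - ζ₀‖ < δ
      · calc _ ≤ ‖H x‖ * 1 := by gcongr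
          _ ≤ _ := by rw [mul_one]; exact hnear x hx1 hxd
      · push Not at hxd
        have h2 : Real.exp (-(M * (1 - (x * conj ζ₀).re))) ≤ Real.exp (-(M * (δ ^ 2 / 2))) := by
          apply Real.exp_le_exp.2
          apply neg_le_neg
          apply mul_le_mul_of_nonneg_left _ hM0
          nlinarith
        have hCx := hC x hx1
        have hd0 : 0 < ‖x - ζ₀‖ := hδ.trans_le hxd
        have hC0 : 0 ≤ C := by
          by_contra hneg
          push Not at hneg
          nlinarith [norm_nonneg (H x)]
        calc _ ≤ (C * ‖x - ζ₀‖) * Real.exp (-(M * (δ ^ 2 / 2))) := by gcongr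
          _ = (C * Real.exp (-(M * (δ ^ 2 / 2)))) * ‖x - ζ₀‖ := by ring
          _ ≤ _ := by gcongr
    have hmain := Complex.norm_le_of_forall_mem_frontier_norm_le Metric.isBounded_ball hB hbd
      (subset_closure hl)
    have hpos : 0 < ‖l - ρ * ζ₀‖ := norm_pos_iff.2 (hne l hl1.le)
    rw [hnorm, mul_inv_le_iff₀ hpos, Real.exp_neg, mul_inv_le_iff₀ (Real.exp_pos _)] at hmain
    linarith
  have hcont : Tendsto (fun ρ : ℝ => η * Real.exp (M * (1 - (l * conj ζ₀).re)) * ‖l - ρ * ζ₀‖)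
      (𝓝[>] 1) (𝓝 (η * Real.exp (M * (1 - (l * conj ζ₀).re)) * ‖l - (1 : ℝ) * ζ₀‖)) := by
    apply tendsto_nhdsWithin_of_tendsto_nhds
    apply Continuous.tendsto
    fun_prop
  have := ge_of_tendsto hcont (eventually_nhdsWithin_of_forall key)
  simpa using this

/-- Differentiability along the circle gives G(ζ) = G(ζ₀) + c(ζ - ζ₀) + o(|ζ - ζ₀|) there. The
previous lemma carries the remainder estimate inside, and Cauchy's estimate on discs of radius
comparable to 1 - r converts it into convergence of G'. -/
lemma tendsto_deriv_radial_of_hasDerivAt_circle {G : ℂ → ℂ} {K : NNReal} (hK : LipschitzWith K G)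
    (hG : DifferentiableOn ℂ G (Metric.ball 0 1)) {t : ℝ}
    (ht : DifferentiableAt ℝ (fun s : ℝ => G (circleMap 0 1 s)) t) :
    ∃ c, Tendsto (fun r : ℝ => deriv G (r * circleMap 0 1 t)) (𝓝[<] 1) (𝓝 c) := by
  set ζ₀ := circleMap 0 1 t with hζ₀def
  have hζ₀ : ‖ζ₀‖ = 1 := by simp [hζ₀def]
  have hζne : ζ₀ ≠ 0 := by intro h; simp [h] at hζ₀
  set d := deriv (fun s : ℝ => G (circleMap 0 1 s)) t
  -- The velocity of `circleMap` at ζ₀ is iζ₀, so c is the complex slope matching d.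
  set c := d / (ζ₀ * Complex.I)
  refine ⟨c, ?_⟩
  let H : ℂ → ℂ := fun l => G l - G ζ₀ - c * (l - ζ₀)
  have hHd : DifferentiableOn ℂ H (Metric.ball 0 1) := by
    have := (hG.sub_const (G ζ₀)).sub
      ((by fun_prop : Differentiable ℂ fun l : ℂ => c * (l - ζ₀)).differentiableOn
        (s := Metric.ball 0 1))
    exact this
  have hHc : Continuous H := by
    have := hK.continuous
    fun_prop
  have hHcl : DiffContOnCl ℂ H (Metric.ball 0 1) := ⟨hHd, hHc.continuousOn⟩
  have hC : ∀ ζ, ‖H ζ‖ ≤ (K + ‖c‖) * ‖ζ - ζ₀‖ := by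
    intro ζ
    calc ‖H ζ‖ ≤ ‖G ζ - G ζ₀‖ + ‖c * (ζ - ζ₀)‖ := norm_sub_le _ _
      _ ≤ K * ‖ζ - ζ₀‖ + ‖c‖ * ‖ζ - ζ₀‖ := by
        rw [norm_mul]
        gcongr
        simpa [dist_eq_norm] using hK.dist_le_mul ζ ζ₀
      _ = _ := by ring
  have hcirc : HasDerivAt (fun s : ℝ => H (circleMap 0 1 s)) 0 t := by
    have h1 := ht.hasDerivAt
    have h2 := hasDerivAt_circleMap 0 1 t
    have h3 := (h1.sub_const (G ζ₀)).sub ((h2.sub_const ζ₀).const_mul c)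
    have hcd : c * (ζ₀ * Complex.I) = d := div_mul_cancel₀ _ (mul_ne_zero hζne Complex.I_ne_zero)
    rw [← hζ₀def, hcd, sub_self] at h3
    exact h3
  -- Near ζ₀ a circle point ζ has parameter t + arg(ζ/ζ₀), a Lipschitz-controlled function of ζ at
  -- ζ₀; this turns o(s - t) into o(ζ - ζ₀).
  have hlit : (fun ζ : ℂ => H (circleMap 0 1 (t + (Complex.log (ζ / ζ₀)).im))) =o[𝓝 ζ₀]
      fun ζ => ζ - ζ₀ := by
    have h1 := hcirc.isLittleO
    have hlog : HasDerivAt (fun ζ : ℂ => Complex.log (ζ / ζ₀)) (1 / ζ₀ / (ζ₀ / ζ₀)) ζ₀ := by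
      refine ((hasDerivAt_id ζ₀).div_const ζ₀).clog ?_
      simp [hζne]
    have htend : Tendsto (fun ζ : ℂ => t + (Complex.log (ζ / ζ₀)).im) (𝓝 ζ₀) (𝓝 t) := by
      have h5 : ContinuousAt (fun ζ : ℂ => t + (Complex.log (ζ / ζ₀)).im) ζ₀ :=
        continuousAt_const.add (Complex.continuous_im.continuousAt.comp hlog.continuousAt)
      have h6 := h5.tendsto
      simpa [hζne] using h6
    have h2 := h1.comp_tendsto htend
    have h3 : (fun ζ : ℂ => (t + (Complex.log (ζ / ζ₀)).im) - t) =O[𝓝 ζ₀] fun ζ => ζ - ζ₀ := by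
      have h4 := hlog.isBigO_sub
      refine Asymptotics.IsBigO.trans (Asymptotics.IsBigO.of_bound 1 (Eventually.of_forall ?_)) h4
      intro ζ
      simp only [hζne, ne_eq, not_false_eq_true, div_self, Complex.log_one, sub_zero,
        add_sub_cancel_left, one_mul]
      simpa using Complex.abs_im_le_norm (Complex.log (ζ / ζ₀))
    have h5 := h2.trans_isBigO h3
    refine h5.congr_left ?_
    intro ζ
    have : H (circleMap 0 1 t) = 0 := by simp [H, ← hζ₀def]
    simp [this]
  have hcircle : ∀ ζ : ℂ, ‖ζ‖ = 1 → circleMap 0 1 (t + (Complex.log (ζ / ζ₀)).im) = ζ := by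
    intro ζ hζ
    have hζ0 : ζ ≠ 0 := by intro h; simp [h] at hζ
    have hnorm : ‖ζ / ζ₀‖ = 1 := by simp [hζ, hζ₀]
    have hlogeq : Complex.log (ζ / ζ₀) = ((Complex.log (ζ / ζ₀)).im : ℂ) * Complex.I := by
      apply Complex.ext <;> simp [Complex.log_re, hζ, hζ₀]
    have hexp : Complex.exp (((Complex.log (ζ / ζ₀)).im : ℂ) * Complex.I) = ζ / ζ₀ := by
      rw [← hlogeq, Complex.exp_log (div_ne_zero hζ0 hζne)]
    have h0 : ζ₀ = Complex.exp (t * Complex.I) := by simp [hζ₀def, circleMap]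
    simp only [circleMap, zero_add, Complex.ofReal_one, one_mul]
    push_cast
    rw [add_mul, Complex.exp_add, hexp, ← h0]
    field_simp
  rw [Metric.tendsto_nhds]
  intro ε hε
  -- Cauchy's estimate below yields 6η = ε/3.
  set η := ε / 18 with hη
  have hηpos : 0 < η := by positivity
  obtain ⟨δ, hδ, hδb⟩ := Metric.eventually_nhds_iff.1 (hlit.def hηpos)
  obtain ⟨M, hM⟩ := norm_le_of_norm_le_on_circle_near hHcl hζ₀ hηpos hδ (fun ζ _ => hC ζ)
    (fun ζ hζ hd => by
      have := hδb (by rwa [dist_eq_norm])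
      rwa [hcircle ζ hζ] at this)
  have hev : ∀ᶠ l in 𝓝 ζ₀, Real.exp (M * (1 - (l * conj ζ₀).re)) < 2 := by
    have hc : Continuous fun l : ℂ => Real.exp (M * (1 - (l * conj ζ₀).re)) := by
      have : Continuous fun l : ℂ => (l * conj ζ₀).re :=
        Complex.continuous_re.comp (continuous_id.mul continuous_const)
      fun_prop
    refine (hc.tendsto ζ₀).eventually_lt_const ?_
    rw [Complex.mul_conj, Complex.normSq_eq_norm_sq, hζ₀]
    norm_num
  obtain ⟨δ', hδ', hδb'⟩ := Metric.eventually_nhds_iff.1 hev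
  have hr1 : ∀ᶠ r : ℝ in 𝓝[<] 1, 0 < r ∧ r < 1 ∧ 2 * (1 - r) < δ' := by
    have h1 : ∀ᶠ r : ℝ in 𝓝[<] 1, 0 < r := nhdsWithin_le_nhds (lt_mem_nhds one_pos)
    have h2 : ∀ᶠ r : ℝ in 𝓝[<] 1, 1 - δ' / 2 < r :=
      nhdsWithin_le_nhds (lt_mem_nhds (by linarith))
    filter_upwards [h1, h2, self_mem_nhdsWithin] with r a b e
    exact ⟨a, e, by linarith⟩
  filter_upwards [hr1] with r ⟨hr0, hr1, hrδ⟩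
  -- The disc of radius R about rζ₀ lies in 𝔻, and its points are within 3R of ζ₀.
  set R := (1 - r) / 2 with hR
  have hRpos : 0 < R := by rw [hR]; linarith
  have hcen : ‖(r : ℂ) * ζ₀‖ = r := by simp [hζ₀, abs_of_pos hr0]
  have hcen2 : ‖(r : ℂ) * ζ₀ - ζ₀‖ = 1 - r := by
    have : (r : ℂ) * ζ₀ - ζ₀ = ((r - 1 : ℝ) : ℂ) * ζ₀ := by push_cast; ring
    rw [this, norm_mul, hζ₀, Complex.norm_real, Real.norm_eq_abs, abs_of_neg (by linarith)]
    ring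
  have hsub : Metric.closedBall ((r : ℂ) * ζ₀) R ⊆ Metric.ball 0 1 := by
    intro x hx
    rw [mem_closedBall_iff_norm] at hx
    rw [mem_ball_zero_iff]
    calc ‖x‖ = ‖(x - r * ζ₀) + r * ζ₀‖ := by ring_nf
      _ ≤ R + r := (norm_add_le _ _).trans (add_le_add hx hcen.le)
      _ < 1 := by rw [hR]; linarith
  have hder : deriv H (r * ζ₀) = deriv G (r * ζ₀) - c := by
    have hGd : DifferentiableAt ℂ G (r * ζ₀) :=
      hG.differentiableAt (Metric.isOpen_ball.mem_nhds (hsub (Metric.mem_closedBall_self hRpos.le)))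
    have h3 := (hGd.hasDerivAt.sub_const (G ζ₀)).sub
      (((hasDerivAt_id ((r : ℂ) * ζ₀)).sub_const ζ₀).const_mul c)
    rw [mul_one] at h3
    exact h3.deriv
  have hest : ‖deriv H (r * ζ₀)‖ ≤ (η * 2 * (3 * R)) / R := by
    apply Complex.norm_deriv_le_of_forall_mem_sphere_norm_le hRpos
    · refine (hHd.mono ?_).diffContOnCl
      rw [closure_ball _ hRpos.ne']
      exact hsub
    · intro x hx
      have hxb := hsub (Metric.sphere_subset_closedBall hx)
      have hx1 : ‖x - ζ₀‖ ≤ 3 * R := by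
        have hx' : ‖x - r * ζ₀‖ = R := by simpa [dist_eq_norm] using hx
        calc ‖x - ζ₀‖ = ‖(x - r * ζ₀) + (r * ζ₀ - ζ₀)‖ := by ring_nf
          _ ≤ R + (1 - r) := (norm_add_le _ _).trans (add_le_add hx'.le hcen2.le)
          _ = 3 * R := by rw [hR]; ring
      refine (hM x hxb).trans ?_
      gcongr
      exact (hδb' (by rw [dist_eq_norm]; linarith)).le
  rw [dist_eq_norm, ← hder]
  refine hest.trans_lt ?_
  have : η * 2 * (3 * R) / R = 6 * η := by field_simp; ring
  rw [this, hη]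
  linarith

/-- **Fatou's theorem**: bounded holomorphic functions on the disc have radial limits a.e. -/
theorem ae_exists_tendsto_radial_of_bounded {f : ℂ → ℂ}
    (hf : DifferentiableOn ℂ f (Metric.ball 0 1)) {C : ℝ}
    (hC : ∀ l ∈ Metric.ball (0 : ℂ) 1, ‖f l‖ ≤ C) :
    ∀ᵐ t : ℝ, ∃ c, Tendsto (fun r : ℝ => f (r * circleMap 0 1 t)) (𝓝[<] 1) (𝓝 c) := by
  -- A primitive of a bounded f is Lipschitz, so it extends to the circle and is differentiable
  -- along it almost everywhere; f is its derivative inside.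
  obtain ⟨F, hF⟩ := hf.isExactOn_ball
  have hlip : LipschitzOnWith (Real.toNNReal C) F (Metric.ball 0 1) := by
    refine (convex_ball (0 : ℂ) 1).lipschitzOnWith_of_nnnorm_hasDerivWithin_le
      (f' := f) (fun x hx => (hF x hx).hasDerivWithinAt) (fun x hx => ?_)
    rw [← NNReal.coe_le_coe]
    exact (hC x hx).trans (Real.le_coe_toNNReal C)
  obtain ⟨G, hG, hFG⟩ := hlip.extend_finite_dimension
  have hcm : LipschitzWith 1 (circleMap 0 1) := by
    simpa using lipschitzWith_circleMap 0 1
  have hcomp : LipschitzWith _ (fun s : ℝ => G (circleMap 0 1 s)) := hG.comp hcm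
  have hGd : ∀ x ∈ Metric.ball (0 : ℂ) 1, HasDerivAt G (f x) x := fun x hx =>
    (hF x hx).congr_of_eventuallyEq
      (eventually_of_mem (Metric.isOpen_ball.mem_nhds hx) fun y hy => (hFG hy).symm)
  filter_upwards [hcomp.ae_differentiableAt_real] with t ht
  obtain ⟨c, hc⟩ := tendsto_deriv_radial_of_hasDerivAt_circle hG
    (fun x hx => (hGd x hx).differentiableAt.differentiableWithinAt) ht
  refine ⟨c, hc.congr' ?_⟩
  have h1 : ∀ᶠ r : ℝ in 𝓝[<] 1, 0 < r := nhdsWithin_le_nhds (lt_mem_nhds one_pos)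
  filter_upwards [h1, self_mem_nhdsWithin] with r hr0 hr1
  refine (hGd _ ?_).deriv
  have : r < 1 := hr1
  simpa [abs_of_pos hr0] using this

/-! ### Half-plane valued functions and a boundary maximum principle -/

lemma exists_seq_radii : ∃ ρ : ℕ → ℝ, (∀ k, 0 < ρ k) ∧ (∀ k, ρ k < 1) ∧
    Tendsto ρ atTop (𝓝[<] 1) := by
  obtain ⟨ρ, -, h1, h2⟩ := exists_seq_strictMono_tendsto' (one_pos : (0 : ℝ) < 1)
  exact ⟨ρ, fun k => (h1 k).1, fun k => (h1 k).2,
    tendsto_nhdsWithin_iff.2 ⟨h2, Eventually.of_forall fun k => (h1 k).2⟩⟩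

lemma circleMap_zero_eq_mul (r t : ℝ) : circleMap 0 r t = r * circleMap 0 1 t := by
  simp [circleMap]

lemma circleMap_mem_unitBall {r : ℝ} (h0 : 0 < r) (h1 : r < 1) (t : ℝ) :
    circleMap 0 r t ∈ Metric.ball (0 : ℂ) 1 := by
  simpa [abs_of_pos h0] using h1

lemma ContinuousOn.continuous_comp_circleMap {f : ℂ → ℂ}
    (hf : ContinuousOn f (Metric.ball 0 1)) {r : ℝ} (h0 : 0 < r) (h1 : r < 1) :
    Continuous fun t : ℝ => f (circleMap 0 r t) :=
  hf.comp_continuous (continuous_circleMap 0 r) (circleMap_mem_unitBall h0 h1)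

lemma integral_re_circleMap {L : ℂ → ℂ} (hL : DifferentiableOn ℂ L (Metric.ball 0 1))
    {r : ℝ} (h0 : 0 < r) (h1 : r < 1) :
    ∫ t in (0)..(2 * Real.pi), (L (circleMap 0 r t)).re = 2 * Real.pi * (L 0).re := by
  have hd : DiffContOnCl ℂ L (Metric.ball 0 |r|) := by
    refine (hL.mono ?_).diffContOnCl
    rw [abs_of_pos h0, closure_ball _ h0.ne']
    exact Metric.closedBall_subset_ball h1
  have h2 := hd.circleAverage
  rw [Real.circleAverage_def] at h2
  have hc := hL.continuousOn.continuous_comp_circleMap h0 h1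
  have h3 := congrArg Complex.re h2
  rw [Complex.smul_re] at h3
  have h4 : (∫ t in (0)..(2 * Real.pi), L (circleMap 0 r t)).re
      = ∫ t in (0)..(2 * Real.pi), (L (circleMap 0 r t)).re := by
    have := Complex.reCLM.intervalIntegral_comp_comm (hc.intervalIntegrable (μ := volume) 0 (2 * Real.pi))
    exact this.symm
  rw [h4, smul_eq_mul] at h3
  have := Real.pi_pos
  field_simp at h3
  linarith

/-- Holomorphic functions with positive real part have finite radial limits a.e. -/
theorem ae_exists_tendsto_radial_of_re_pos {p : ℂ → ℂ}
    (hp : DifferentiableOn ℂ p (Metric.ball 0 1))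
    (hpos : ∀ l ∈ Metric.ball (0 : ℂ) 1, 0 < (p l).re) :
    ∀ᵐ t : ℝ ∂(volume.restrict (Ioc 0 (2 * Real.pi))),
      ∃ c, Tendsto (fun r : ℝ => p (r * circleMap 0 1 t)) (𝓝[<] 1) (𝓝 c) := by
  obtain ⟨ρ, hρ0, hρ1, hρ⟩ := exists_seq_radii
  have hre : ∀ l ∈ Metric.ball (0 : ℂ) 1, 1 < (1 + p l).re := fun l hl => by
    simpa using hpos l hl
  have hne : ∀ l ∈ Metric.ball (0 : ℂ) 1, 1 + p l ≠ 0 := fun l hl h => by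
    have := hre l hl
    rw [h] at this
    norm_num at this
  have hnorm : ∀ l ∈ Metric.ball (0 : ℂ) 1, 1 ≤ ‖1 + p l‖ := fun l hl =>
    (hre l hl).le.trans (Complex.re_le_norm _)
  -- (1 + p)⁻¹ is bounded by 1, so Fatou's theorem applies; p has a finite limit wherever that of (1
  -- + p)⁻¹ is nonzero.
  have hm : DifferentiableOn ℂ (fun l => (1 + p l)⁻¹) (Metric.ball 0 1) :=
    ((differentiableOn_const 1).add hp).inv hne
  have hmrad := ae_exists_tendsto_radial_of_bounded hm (C := 1) fun l hl => by
    rw [norm_inv]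
    exact inv_le_one_of_one_le₀ (hnorm l hl)
  -- Re L = log|1 + p| is nonnegative and harmonic, so its circle means are constant. Fatou's lemma
  -- then makes its liminf finite almost everywhere, which excludes the limit 0 for (1 + p)⁻¹.
  let L : ℂ → ℂ := fun l => Complex.log (1 + p l)
  have hL : DifferentiableOn ℂ L (Metric.ball 0 1) :=
    ((differentiableOn_const 1).add hp).clog fun l hl => Or.inl (one_pos.trans (hre l hl))
  have hLre : ∀ l, (L l).re = Real.log ‖1 + p l‖ := fun l => Complex.log_re _
  let u : ℕ → ℝ → ENNReal := fun k t => ENNReal.ofReal (L (circleMap 0 (ρ k) t)).re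
  have hcont : ∀ k, Continuous fun t : ℝ => (L (circleMap 0 (ρ k) t)).re := fun k =>
    Complex.continuous_re.comp (hL.continuousOn.continuous_comp_circleMap (hρ0 k) (hρ1 k))
  have hu : ∀ k, Measurable (u k) := fun k => (hcont k).measurable.ennreal_ofReal
  have hint : ∀ k, ∫⁻ t in Ioc 0 (2 * Real.pi), u k t = ENNReal.ofReal (2 * Real.pi * (L 0).re) := by
    intro k
    rw [← integral_re_circleMap hL (hρ0 k) (hρ1 k),
      intervalIntegral.integral_of_le Real.two_pi_pos.le,
      ofReal_integral_eq_lintegral_ofReal]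
    · exact ((hcont k).intervalIntegrable 0 (2 * Real.pi)).1
    · refine Eventually.of_forall fun t => ?_
      change 0 ≤ (L (circleMap 0 (ρ k) t)).re
      rw [hLre]
      exact Real.log_nonneg (hnorm _ (circleMap_mem_unitBall (hρ0 k) (hρ1 k) t))
  have hfin : ∫⁻ t in Ioc 0 (2 * Real.pi), liminf (fun k => u k t) atTop ≠ ⊤ := by
    refine ne_top_of_le_ne_top ?_ (lintegral_liminf_le hu)
    simp [hint]
  filter_upwards [ae_restrict_of_ae hmrad, ae_lt_top (Measurable.liminf hu) hfin] with t ⟨c, hc⟩ ht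
  have hc0 : c ≠ 0 := by
    rintro rfl
    have h1 : Tendsto (fun k => ‖(1 + p (circleMap 0 (ρ k) t))⁻¹‖) atTop (𝓝[>] 0) := by
      refine tendsto_nhdsWithin_iff.2 ⟨?_, Eventually.of_forall fun k => ?_⟩
      · have := (hc.comp hρ).norm
        simp only [norm_zero] at this
        refine this.congr fun k => ?_
        simp only [Function.comp_apply]
        rw [circleMap_zero_eq_mul (ρ k)]
      · exact norm_pos_iff.2 (inv_ne_zero (hne _ (circleMap_mem_unitBall (hρ0 k) (hρ1 k) t)))
    have h2 : Tendsto (fun k => u k t) atTop (𝓝 ⊤) := by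
      refine (ENNReal.tendsto_ofReal_atTop.comp
        (Real.tendsto_log_atTop.comp h1.inv_tendsto_nhdsGT_zero)).congr fun k => ?_
      simp [u, hLre]
    rw [h2.liminf_eq] at ht
    exact lt_irrefl _ ht
  refine ⟨c⁻¹ - 1, ((hc.inv₀ hc0).sub_const 1).congr fun r => ?_⟩
  rw [inv_inv]
  ring

/-- A holomorphic function whose real part is bounded above and has nonpositive radial limits
almost everywhere has nonpositive real part. -/
theorem re_nonpos_of_ae_radial {Q : ℂ → ℂ} (hQ : DifferentiableOn ℂ Q (Metric.ball 0 1)) {M : ℝ}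
    (hM : ∀ l ∈ Metric.ball (0 : ℂ) 1, (Q l).re ≤ M)
    (hrad : ∀ᵐ t : ℝ ∂(volume.restrict (Ioc 0 (2 * Real.pi))),
      ∃ c : ℂ, Tendsto (fun r : ℝ => Q (r * circleMap 0 1 t)) (𝓝[<] 1) (𝓝 c) ∧ c.re ≤ 0)
    {w : ℂ} (hw : w ∈ Metric.ball (0 : ℂ) 1) : (Q w).re ≤ 0 := by
  obtain ⟨ρ, hρ0, hρ1, hρ⟩ := exists_seq_radii
  have hw1 : ‖w‖ < 1 := by simpa using hw
  have hρt : Tendsto ρ atTop (𝓝 1) := hρ.mono_right nhdsWithin_le_nhds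
  -- Cauchy's formula for exp(NQ) on circles of radius ρ → 1 gives a bound independent of N; this is
  -- impossible for N → ∞ if Re Q(w) > 0.
  have key : ∀ N : ℕ, Real.exp (N * (Q w).re) ≤ (1 - ‖w‖)⁻¹ := by
    intro N
    let f : ℂ → ℂ := fun l => Complex.exp (N * Q l)
    have hf : DifferentiableOn ℂ f (Metric.ball 0 1) := (hQ.const_mul (N : ℂ)).cexp
    have hfn : ∀ l, ‖f l‖ = Real.exp (N * (Q l).re) := fun l => by simp [f, Complex.norm_exp]
    -- The truncation below by 1 makes the almost everywhere limit exactly 1.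
    let v : ℕ → ℝ → ℝ := fun k t => max ‖f (circleMap 0 (ρ k) t)‖ 1
    have hvc : ∀ k, Continuous (v k) := fun k =>
      (hf.continuousOn.continuous_comp_circleMap (hρ0 k) (hρ1 k)).norm.max continuous_const
    have hlim : Tendsto (fun k => ∫ t in (0)..(2 * Real.pi), v k t) atTop
        (𝓝 (∫ t in (0)..(2 * Real.pi), (1 : ℝ))) := by
      refine intervalIntegral.tendsto_integral_filter_of_dominated_convergence
        (fun _ => max (Real.exp (N * M)) 1) ?_ ?_ ?_ ?_
      · exact Eventually.of_forall fun k => (hvc k).aestronglyMeasurable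
      · refine Eventually.of_forall fun k => Eventually.of_forall fun t _ => ?_
        rw [Real.norm_of_nonneg (zero_le_one.trans (le_max_right _ _))]
        refine max_le_max ?_ le_rfl
        rw [hfn]
        have := hM _ (circleMap_mem_unitBall (hρ0 k) (hρ1 k) t)
        gcongr
      · exact intervalIntegrable_const
      · rw [ae_restrict_iff' measurableSet_Ioc] at hrad
        filter_upwards [hrad] with t ht htm
        rw [uIoc_of_le Real.two_pi_pos.le] at htm
        obtain ⟨c, hc, hc0⟩ := ht htm
        have h1 : Tendsto (fun k => v k t) atTop (𝓝 (max (Real.exp (N * c.re)) 1)) := by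
          refine Tendsto.max ?_ tendsto_const_nhds
          have h2 := ((by fun_prop : Continuous fun z : ℂ => Real.exp (N * z.re)).tendsto c).comp (hc.comp hρ)
          refine h2.congr fun k => ?_
          rw [hfn, circleMap_zero_eq_mul (ρ k)]
          rfl
        rwa [max_eq_right] at h1
        rw [Real.exp_le_one_iff]
        exact mul_nonpos_of_nonneg_of_nonpos (Nat.cast_nonneg N) hc0
    have hlim2 : Tendsto (fun k => (ρ k - ‖w‖)⁻¹ * ((2 * Real.pi)⁻¹ *
        ∫ t in (0)..(2 * Real.pi), v k t)) atTop (𝓝 ((1 - ‖w‖)⁻¹ * ((2 * Real.pi)⁻¹ *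
        ∫ t in (0)..(2 * Real.pi), (1 : ℝ)))) :=
      ((hρt.sub_const _).inv₀ (by linarith)).mul (hlim.const_mul _)
    have hone : (2 * Real.pi)⁻¹ * ∫ t in (0)..(2 * Real.pi), (1 : ℝ) = 1 := by
      have := Real.pi_pos
      simp
      field_simp
    rw [hone, mul_one] at hlim2
    refine ge_of_tendsto hlim2 ?_
    filter_upwards [hρt.eventually_const_lt hw1] with k hk
    have hd : DiffContOnCl ℂ f (Metric.ball 0 |ρ k|) := by
      refine (hf.mono ?_).diffContOnCl
      rw [abs_of_pos (hρ0 k), closure_ball _ (hρ0 k).ne']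
      exact Metric.closedBall_subset_ball (hρ1 k)
    have havg := hd.circleAverage_smul_div (w := w)
      (by simpa [abs_of_pos (hρ0 k)] using hk)
    rw [Real.circleAverage_def] at havg
    rw [← hfn, ← havg, norm_smul, Real.norm_of_nonneg (by positivity)]
    rw [mul_left_comm, ← intervalIntegral.integral_const_mul]
    refine mul_le_mul_of_nonneg_left ?_ (by positivity)
    refine intervalIntegral.norm_integral_le_of_norm_le Real.two_pi_pos.le
      (Eventually.of_forall fun t _ => ?_) (((hvc k).const_mul _).intervalIntegrable _ _)
    have hnc : ‖circleMap 0 (ρ k) t‖ = ρ k := by simp [abs_of_pos (hρ0 k)]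
    have hdist : ρ k - ‖w‖ ≤ ‖circleMap 0 (ρ k) t - w‖ := by
      have := norm_sub_norm_le (circleMap 0 (ρ k) t) w
      rwa [hnc] at this
    rw [norm_smul, sub_zero, norm_div, hnc]
    refine mul_le_mul ?_ (le_max_left _ _) (norm_nonneg _) (inv_nonneg.2 (by linarith))
    rw [div_eq_mul_inv]
    calc ρ k * ‖circleMap 0 (ρ k) t - w‖⁻¹ ≤ 1 * (ρ k - ‖w‖)⁻¹ := by
          have := sub_pos.2 hk
          have := (hρ1 k).le
          gcongr
      _ = _ := one_mul _
  by_contra hpos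
  push Not at hpos
  have ht : Tendsto (fun N : ℕ => Real.exp (N * (Q w).re)) atTop atTop :=
    Real.tendsto_exp_atTop.comp (tendsto_natCast_atTop_atTop.atTop_mul_const hpos)
  obtain ⟨N, hN⟩ := (ht.eventually_gt_atTop (1 - ‖w‖)⁻¹).exists
  exact absurd (key N) (not_le.2 hN)

/-! ### Radial limits in taut convex tubes -/

/-- If Ω contained the line, the discs λ ↦ x + kλv would all lie in the tube. They are fixed at 0,
hence not compactly divergent, yet unbounded at 1/2 along any subsequence. -/
lemma IsTaut.exists_add_smul_notMem {n : ℕ} {Ω : Set (Fin n → ℝ)} (h : IsTaut (tubeOver Ω))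
    {x v : Fin n → ℝ} (hx : x ∈ Ω) (hv : v ≠ 0) : ∃ t : ℝ, x + t • v ∉ Ω := by
  by_contra! hline
  let f : ℕ → ℂ → Fin n → ℂ := fun k l j => x j + k * l * v j
  obtain ⟨σ, hσ, H⟩ := h f fun k => by
    refine ⟨?_, fun l _ => ?_⟩
    · exact (by fun_prop : Differentiable ℂ (f k)).differentiableOn
    · have := hline (k * l.re)
      change (fun j => (f k l j).re) ∈ Ω
      convert this using 1
      funext j
      simp [f]
  rcases H with ⟨g, -, hg⟩ | hdiv
  · obtain ⟨j, hj⟩ := Function.ne_iff.1 hv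
    have hhalf : (1 / 2 : ℂ) ∈ Metric.ball (0 : ℂ) 1 := by simp; norm_num
    have h1 := (tendsto_pi_nhds.1 (hg.tendsto_at hhalf) j).norm
    have h2 := (h1.add_const ‖(x j : ℂ)‖)
    have h3 : Tendsto (fun k => (σ k : ℝ) * (1 / 2 * |v j|)) atTop atTop :=
      (tendsto_natCast_atTop_atTop.comp hσ.tendsto_atTop).atTop_mul_const
        (by have : 0 < |v j| := abs_pos.2 hj
            positivity)
    refine not_tendsto_nhds_of_tendsto_atTop (tendsto_atTop_mono (fun k => ?_) h3) _ h2
    calc (σ k : ℝ) * (1 / 2 * |v j|) = ‖f (σ k) (1 / 2) j - x j‖ := by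
          simp [f]; ring
      _ ≤ _ := norm_sub_le _ _
  · have h1 := hdiv {0} (by simp) isCompact_singleton {fun j => (x j : ℂ)}
      (by simpa [tubeOver] using hx) isCompact_singleton
    obtain ⟨k, hk⟩ := h1.exists
    refine Set.disjoint_left.1 hk (mem_image_of_mem _ (mem_singleton 0)) ?_
    simp [f]

/-- Otherwise some v ≠ 0 is annihilated by all these functionals. Separating Ω from a point x + tv
outside it gives one more such functional c, with c·x < c·(x + tv) = c·x. -/
lemma span_bddAbove_functionals_eq_top {n : ℕ} {Ω : Set (Fin n → ℝ)} (ho : IsOpen Ω)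
    (hne : Ω.Nonempty) (hc : Convex ℝ Ω)
    (hline : ∀ x ∈ Ω, ∀ v : Fin n → ℝ, v ≠ 0 → ∃ t : ℝ, x + t • v ∉ Ω) :
    Submodule.span ℝ {c : Fin n → ℝ | ∃ M, ∀ x ∈ Ω, c ⬝ᵥ x ≤ M} = ⊤ := by
  by_contra hspan
  obtain ⟨f, hf0, hf⟩ := Submodule.exists_le_ker_of_lt_top _ (lt_top_iff_ne_top.2 hspan)
  let v : Fin n → ℝ := fun j => f (Pi.single j 1)
  have hfv : ∀ c, f c = c ⬝ᵥ v := fun c => by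
    rw [LinearMap.pi_apply_eq_sum_univ f c]
    refine Finset.sum_congr rfl fun j _ => ?_
    simp only [smul_eq_mul, v]
    congr 2
    funext i
    simp [Pi.single_apply, eq_comm]
  have hv : v ≠ 0 := by
    intro hv
    refine hf0 (LinearMap.ext fun c => ?_)
    rw [hfv, hv]
    simp
  obtain ⟨x, hx⟩ := hne
  obtain ⟨t, ht⟩ := hline x hx v hv
  obtain ⟨g, hg⟩ := geometric_hahn_banach_open_point hc ho ht
  let c : Fin n → ℝ := fun j => g (Pi.single j 1)
  have hgc : ∀ y, g y = c ⬝ᵥ y := fun y => by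
    have := LinearMap.pi_apply_eq_sum_univ (g : (Fin n → ℝ) →ₗ[ℝ] ℝ) y
    simp only [ContinuousLinearMap.coe_coe] at this
    rw [this]
    refine Finset.sum_congr rfl fun j _ => ?_
    simp only [smul_eq_mul, c]
    rw [mul_comm]
    congr 2
    funext i
    simp [Pi.single_apply, eq_comm]
  have hmem : c ∈ {c : Fin n → ℝ | ∃ M, ∀ x ∈ Ω, c ⬝ᵥ x ≤ M} :=
    ⟨g (x + t • v), fun y hy => by rw [← hgc]; exact (hg y hy).le⟩
  have h0 : c ⬝ᵥ v = 0 := by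
    rw [← hfv]
    exact hf (Submodule.subset_span hmem)
  have := hg x hx
  rw [hgc, hgc, dotProduct_add, dotProduct_smul, h0] at this
  simp at this

/-- Holomorphic discs in a taut convex tube domain have radial limits almost everywhere. -/
theorem IsHolomorphicDisc.ae_exists_isRadialLimit {n : ℕ} {D : Set (Fin n → ℂ)}
    (hD : IsConvexTubeDomain D) (hDtaut : IsTaut D) {φ : ℂ → Fin n → ℂ}
    (hφ : IsHolomorphicDisc D φ) :
    ∀ᵐ t : ℝ ∂(volume.restrict (Ioc 0 (2 * Real.pi))),
      ∃ w, IsRadialLimit φ (circleMap 0 1 t) w := by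
  obtain ⟨Ω, ho, hne, hc, rfl⟩ := hD
  have hφj : ∀ j, DifferentiableOn ℂ (fun l => φ l j) (Metric.ball 0 1) :=
    differentiableOn_pi.1 hφ.1
  have hall : ∀ c : Fin n → ℝ, ∀ᵐ t : ℝ ∂(volume.restrict (Ioc 0 (2 * Real.pi))),
      ∃ y, Tendsto (fun r : ℝ => ∑ j, (c j : ℂ) * φ (r * circleMap 0 1 t) j) (𝓝[<] 1) (𝓝 y) := by
    intro c
    have hcm : c ∈ Submodule.span ℝ {c : Fin n → ℝ | ∃ M, ∀ x ∈ Ω, c ⬝ᵥ x ≤ M} := by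
      rw [span_bddAbove_functionals_eq_top ho hne hc
        fun x hx v hv => hDtaut.exists_add_smul_notMem hx hv]
      exact Submodule.mem_top
    induction hcm using Submodule.span_induction with
    | mem c hcM =>
      obtain ⟨M, hM⟩ := hcM
      have hp : DifferentiableOn ℂ (fun l => ((M + 1 : ℝ) : ℂ) - ∑ j, (c j : ℂ) * φ l j)
          (Metric.ball 0 1) :=
        (differentiableOn_const _).sub
          (DifferentiableOn.fun_sum fun j _ => (hφj j).const_mul _)
      have h1 := ae_exists_tendsto_radial_of_re_pos hp fun l hl => by
        have := hM _ (hφ.2 hl)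
        simp only [dotProduct] at this
        simp only [Complex.sub_re, Complex.ofReal_re, Complex.re_sum, Complex.re_ofReal_mul]
        linarith
      filter_upwards [h1] with t ⟨y, hy⟩
      refine ⟨((M + 1 : ℝ) : ℂ) - y, (hy.const_sub ((M + 1 : ℝ) : ℂ)).congr fun r => ?_⟩
      ring
    | zero => exact Eventually.of_forall fun t => ⟨0, by simp⟩
    | add c d _ _ hc hd =>
      filter_upwards [hc, hd] with t ⟨y, hy⟩ ⟨y', hy'⟩
      refine ⟨y + y', (hy.add hy').congr fun r => ?_⟩
      simp [add_mul, Finset.sum_add_distrib]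
    | smul a c _ hc =>
      filter_upwards [hc] with t ⟨y, hy⟩
      refine ⟨a * y, (hy.const_mul (a : ℂ)).congr fun r => ?_⟩
      simp [Finset.mul_sum, mul_assoc]
  have hcoord := ae_all_iff.2 fun j : Fin n => hall (Pi.single j 1)
  filter_upwards [hcoord] with t ht
  choose w hw using ht
  refine ⟨w, tendsto_pi_nhds.2 fun j => (hw j).congr fun r => ?_⟩
  rw [Finset.sum_eq_single j] <;> simp +contextual

/-! ### Zeros of generators and their perturbation -/

lemma re_neg_of_re_neg_on_sphere {f : ℂ → ℂ} {r : ℝ} (hr : 0 < r)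
    (hf : DiffContOnCl ℂ f (Metric.ball 0 r)) (h : ∀ l, ‖l‖ = r → (f l).re < 0)
    {l : ℂ} (hl : ‖l‖ ≤ r) : (f l).re < 0 := by
  have hcl : closure (Metric.ball (0 : ℂ) r) = Metric.closedBall 0 r := closure_ball _ hr.ne'
  have hcont : ContinuousOn (fun l => (f l).re) (Metric.sphere 0 r) :=
    Complex.continuous_re.comp_continuousOn
      (hf.continuousOn.mono (by rw [hcl]; exact Metric.sphere_subset_closedBall))
  obtain ⟨x, hx, hmax⟩ := (isCompact_sphere (0 : ℂ) r).exists_isMaxOn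
    (NormedSpace.sphere_nonempty.2 hr.le) hcont
  have hfe : DiffContOnCl ℂ (fun l => Complex.exp (f l)) (Metric.ball 0 r) :=
    ⟨hf.differentiableOn.cexp, hf.continuousOn.cexp⟩
  have := Complex.norm_le_of_forall_mem_frontier_norm_le Metric.isBounded_ball hfe
    (C := Real.exp (f x).re) (fun z hz => ?_) (z := l) (by rw [hcl]; simpa using hl)
  · rw [Complex.norm_exp, Real.exp_le_exp] at this
    exact this.trans_lt (h x (by simpa using hx))
  · rw [frontier_ball _ hr.ne'] at hz
    rw [Complex.norm_exp, Real.exp_le_exp]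
    exact hmax hz

/-- Without a zero, λ/E(λ) is holomorphic with negative real part on the circle, hence inside, but
it vanishes at 0. -/
lemma exists_zero_of_re_conj_mul_neg {E : ℂ → ℂ} (hE : DifferentiableOn ℂ E (Metric.ball 0 1))
    {r : ℝ} (hr : 0 < r) (hr1 : r < 1) (h : ∀ l, ‖l‖ = r → (conj l * E l).re < 0) :
    ∃ c, ‖c‖ < r ∧ E c = 0 := by
  by_contra! hne
  have hne' : ∀ l, ‖l‖ ≤ r → E l ≠ 0 := fun l hl h0 => by
    rcases hl.lt_or_eq with hl | hl
    · exact hne l hl h0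
    · have := h l hl
      simp [h0] at this
  have hd : DiffContOnCl ℂ (fun l => l / E l) (Metric.ball 0 r) := by
    refine DifferentiableOn.diffContOnCl ?_
    rw [closure_ball _ hr.ne']
    exact differentiableOn_id.div (hE.mono (Metric.closedBall_subset_ball hr1))
      fun l hl => hne' l (by simpa using hl)
  have := re_neg_of_re_neg_on_sphere hr hd (fun l hl => ?_) (l := 0) (by simpa using hr.le)
  · simp at this
  · have h1 := h l hl
    have h2 : 0 < Complex.normSq (E l) := Complex.normSq_pos.2 (hne' l hl.le)
    rw [Complex.div_re, ← add_div]
    apply div_neg_of_neg_of_pos _ h2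
    simpa using h1

/-- For |λ| = r one has r² - c̄λ = λ·conj(λ - c), so dividing E(λ)/(λ - c) by r² - c̄λ leaves a
positive multiple of λ̄E(λ). The quotient therefore has negative real part on the whole closed disc,
and E(λ)/(λ - c) never vanishes, even at c. -/
lemma deriv_ne_zero_and_unique_of_re_conj_mul_neg {E : ℂ → ℂ}
    (hE : DifferentiableOn ℂ E (Metric.ball 0 1))
    {r : ℝ} (hr : 0 < r) (hr1 : r < 1) (h : ∀ l, ‖l‖ = r → (conj l * E l).re < 0)
    {c : ℂ} (hc : ‖c‖ < r) (hEc : E c = 0) :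
    deriv E c ≠ 0 ∧ ∀ l, ‖l‖ ≤ r → E l = 0 → l = c := by
  have hcb : Metric.ball (0 : ℂ) 1 ∈ 𝓝 c :=
    Metric.isOpen_ball.mem_nhds (by simpa using hc.trans hr1)
  have hden : ∀ l : ℂ, ‖l‖ ≤ r → (r : ℂ) ^ 2 - conj c * l ≠ 0 := fun l hl h0 => by
    rw [sub_eq_zero] at h0
    have h1 := congrArg norm h0
    simp only [norm_pow, Complex.norm_real, Real.norm_eq_abs, sq_abs, norm_mul,
      RCLike.norm_conj] at h1
    nlinarith [norm_nonneg c, norm_nonneg l]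
  have hd : DiffContOnCl ℂ (fun l => dslope E c l / ((r : ℂ) ^ 2 - conj c * l))
      (Metric.ball 0 r) := by
    refine DifferentiableOn.diffContOnCl ?_
    rw [closure_ball _ hr.ne']
    exact ((((Complex.differentiableOn_dslope hcb).2 hE)).mono
      (Metric.closedBall_subset_ball hr1)).div (by fun_prop)
      fun l hl => hden l (by simpa using hl)
  have hneg : ∀ l, ‖l‖ ≤ r → dslope E c l ≠ 0 := fun l hl h0 => by
    have := re_neg_of_re_neg_on_sphere hr hd (fun x hx => ?_) hl
    · simp [h0] at this
    · have hxc : x ≠ c := fun hxc => by rw [hxc] at hx; exact hc.ne hx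
      have hx0 : x ≠ 0 := fun h0 => by simp [h0] at hx; exact hr.ne hx
      have hxx : conj x * x = (r : ℂ) ^ 2 := by
        rw [mul_comm, Complex.mul_conj, Complex.normSq_eq_norm_sq, hx]
        push_cast
        rfl
      have hxc2 : 0 < Complex.normSq (x - c) := Complex.normSq_pos.2 (sub_ne_zero.2 hxc)
      have heq : dslope E c x / ((r : ℂ) ^ 2 - conj c * x)
          = (((Complex.normSq (x - c))⁻¹ * (r ^ 2)⁻¹ : ℝ) : ℂ) * (conj x * E x) := by
        rw [dslope_of_ne _ hxc, slope_def_field, hEc, sub_zero]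
        push_cast
        rw [← hxx, Complex.normSq_eq_conj_mul_self, map_sub]
        have h1 : x - c ≠ 0 := sub_ne_zero.2 hxc
        have h2 : conj x - conj c ≠ 0 := by
          rw [← map_sub]
          exact (map_ne_zero _).2 h1
        have h3 : conj x ≠ 0 := (map_ne_zero _).2 hx0
        rw [← sub_mul]
        field_simp
      rw [heq, Complex.re_ofReal_mul]
      exact mul_neg_of_pos_of_neg (by positivity) (h x hx)
  refine ⟨?_, fun l hl hl0 => ?_⟩
  · simpa using hneg c hc.le
  · by_contra hlc
    apply hneg l hl
    rw [dslope_of_ne _ hlc, slope_def_field, hEc, hl0]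
    simp

/-- Perturbed Berkson–Porta generators have exactly one zero in the disc, and it is simple. -/
lemma exists_unique_simple_zero {α : ℂ} {Q : ℂ → ℂ} (hQ : DifferentiableOn ℂ Q (Metric.ball 0 1))
    (hre : ∀ l ∈ Metric.ball (0 : ℂ) 1, (Q l).re ≤ 0) {ε : ℝ} (hε : 0 < ε) {E : ℂ → ℂ}
    (hE : ∀ l ∈ Metric.ball (0 : ℂ) 1, E l = α - conj α * l ^ 2 + l * (Q l - ε)) :
    ∃ c ∈ Metric.ball (0 : ℂ) 1, E c = 0 ∧ deriv E c ≠ 0 ∧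
      ∀ l ∈ Metric.ball (0 : ℂ) 1, E l = 0 → l = c := by
  have hEd : DifferentiableOn ℂ E (Metric.ball 0 1) := by
    refine DifferentiableOn.congr ?_ hE
    fun_prop
  have hev : ∀ᶠ r : ℝ in 𝓝[<] 1, 0 < r ∧ r < 1 ∧ ∀ l, ‖l‖ = r → (conj l * E l).re < 0 := by
    have h1 : ∀ᶠ r : ℝ in 𝓝[<] 1, 0 < r := nhdsWithin_le_nhds (lt_mem_nhds one_pos)
    -- With Re Q ≤ 0, this expression dominates Re(λ̄E(λ)) on |λ| = r; it tends to -ε as r → 1.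
    have h2 : ∀ᶠ r : ℝ in 𝓝[<] 1, (1 - r ^ 2) * ‖α‖ - r ^ 2 * ε < 0 := by
      have hc : Continuous fun r : ℝ => (1 - r ^ 2) * ‖α‖ - r ^ 2 * ε := by fun_prop
      refine nhdsWithin_le_nhds ((hc.tendsto 1).eventually_lt_const ?_)
      simpa using hε
    filter_upwards [h1, h2, self_mem_nhdsWithin] with r hr0 hr hr1
    refine ⟨hr0, hr1, fun l hl => ?_⟩
    have hr1' : r < 1 := hr1
    have hlb : l ∈ Metric.ball (0 : ℂ) 1 := by simpa [hl] using hr1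
    have hll : conj l * l = ((r ^ 2 : ℝ) : ℂ) := by
      rw [mul_comm, Complex.mul_conj, Complex.normSq_eq_norm_sq, hl]
    have heq : conj l * E l = conj l * α - ((r ^ 2 : ℝ) : ℂ) * conj (conj l * α)
        + ((r ^ 2 : ℝ) : ℂ) * (Q l - ε) := by
      rw [hE l hlb, ← hll, map_mul, Complex.conj_conj]
      ring
    rw [heq, Complex.add_re, Complex.sub_re, Complex.re_ofReal_mul, Complex.re_ofReal_mul,
      Complex.conj_re, Complex.sub_re, Complex.ofReal_re]
    have h3 : (conj l * α).re ≤ ‖α‖ := by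
      refine (Complex.re_le_norm _).trans ?_
      rw [norm_mul, RCLike.norm_conj, hl]
      exact mul_le_of_le_one_left (norm_nonneg _) hr1'.le
    have h4 := hre l hlb
    have h5 : 0 ≤ 1 - r ^ 2 := by nlinarith
    nlinarith [mul_le_mul_of_nonneg_left h3 h5, mul_nonneg (sq_nonneg r) (neg_nonneg.2 h4)]
  obtain ⟨r, hr0, hr1, hr⟩ := hev.exists
  obtain ⟨c, hc, hc0⟩ := exists_zero_of_re_conj_mul_neg hEd hr0 hr1 hr
  refine ⟨c, by simpa using hc.trans hr1, hc0,
    (deriv_ne_zero_and_unique_of_re_conj_mul_neg hEd hr0 hr1 hr hc hc0).1, fun l hl hl0 => ?_⟩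
  have hl1 : ‖l‖ < 1 := by simpa using hl
  have h1 : ∀ᶠ r : ℝ in 𝓝[<] 1, max ‖l‖ ‖c‖ < r :=
    nhdsWithin_le_nhds (lt_mem_nhds (max_lt hl1 (hc.trans hr1)))
  obtain ⟨s, ⟨hs0, hs1, hs⟩, hls⟩ := (hev.and h1).exists
  exact (deriv_ne_zero_and_unique_of_re_conj_mul_neg hEd hs0 hs1 hs
    ((le_max_right _ _).trans_lt hls) hc0).2 l ((le_max_left _ _).trans hls.le) hl0

/-- A Hurwitz argument: μ is an isolated zero of e. If e - ελ had no zero near μ, the maximum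
principle for its reciprocal would give min|e| - ε ≤ ε|μ|, the minimum being over a small circle,
which fails for small ε. -/
lemma tendsto_zero_of_perturbation {e : ℂ → ℂ} (he : DifferentiableOn ℂ e (Metric.ball 0 1))
    {μ : ℂ} (hμ : μ ∈ Metric.ball (0 : ℂ) 1) (heμ : e μ = 0)
    (hne : ∃ l ∈ Metric.ball (0 : ℂ) 1, e l ≠ 0) {f : ℝ → ℂ}
    (hf : ∀ ε : ℝ, 0 < ε → ∀ l ∈ Metric.ball (0 : ℂ) 1, e l - ε * l = 0 → l = f ε) :
    Tendsto f (𝓝[>] 0) (𝓝 μ) := by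
  have hμ1 : ‖μ‖ < 1 := by simpa using hμ
  have han : AnalyticOnNhd ℂ e (Metric.ball 0 1) := he.analyticOnNhd Metric.isOpen_ball
  have hev : ∀ᶠ l in 𝓝[≠] μ, e l ≠ 0 := by
    by_contra hfr
    rw [Filter.not_eventually] at hfr
    obtain ⟨l, hl, hl0⟩ := hne
    refine hl0 (han.eqOn_zero_of_preconnected_of_frequently_eq_zero
      (convex_ball (0 : ℂ) 1).isPreconnected hμ (hfr.mono fun x hx => ?_) hl)
    simpa using hx
  rw [eventually_nhdsWithin_iff] at hev
  obtain ⟨s₀, hs₀, hs₀b⟩ := Metric.eventually_nhds_iff.1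
    (hev.and (Metric.isOpen_ball.mem_nhds hμ))
  rw [Metric.tendsto_nhds]
  intro ε' hε'
  set s := min (s₀ / 2) (ε' / 2)
  have hs : 0 < s := by positivity
  have hss₀ : s < s₀ := (min_le_left _ _).trans_lt (by linarith)
  have hsε : s < ε' := (min_le_right _ _).trans_lt (by linarith)
  have hsub : Metric.closedBall μ s ⊆ Metric.ball 0 1 := fun x hx =>
    (hs₀b ((Metric.mem_closedBall.1 hx).trans_lt hss₀)).2
  have hecont : ContinuousOn (fun l => ‖e l‖) (Metric.sphere μ s) :=
    (he.continuousOn.mono (Metric.sphere_subset_closedBall.trans hsub)).norm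
  obtain ⟨x, hx, hmin⟩ := (isCompact_sphere μ s).exists_isMinOn
    (NormedSpace.sphere_nonempty.2 hs.le) hecont
  have hδ : 0 < ‖e x‖ := by
    refine norm_pos_iff.2 ((hs₀b ((Metric.mem_sphere.1 hx).trans_lt hss₀)).1 ?_)
    rintro rfl
    simp at hx
    exact hs.ne hx
  have hsmall : ∀ᶠ ε : ℝ in 𝓝[>] 0, ε < ‖e x‖ / 2 :=
    nhdsWithin_le_nhds (gt_mem_nhds (by positivity))
  filter_upwards [hsmall, self_mem_nhdsWithin] with ε hε1 hε
  have hε0 : 0 < ε := hε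
  obtain ⟨l, hl, hl0⟩ : ∃ l ∈ Metric.closedBall μ s, e l - ε * l = 0 := by
    by_contra! hno
    have hcl : closure (Metric.ball μ s) = Metric.closedBall μ s := closure_ball _ hs.ne'
    have hd : DiffContOnCl ℂ (fun l => (e l - ε * l)⁻¹) (Metric.ball μ s) := by
      refine DifferentiableOn.diffContOnCl ?_
      rw [hcl]
      exact ((he.mono hsub).sub (by fun_prop)).inv hno
    have hbd := Complex.norm_le_of_forall_mem_frontier_norm_le Metric.isBounded_ball hd
      (C := (‖e x‖ - ε)⁻¹) (fun z hz => ?_) (subset_closure (Metric.mem_ball_self hs))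
    · rw [heμ, zero_sub, norm_inv, norm_neg, norm_mul, Complex.norm_real,
        Real.norm_of_nonneg hε0.le] at hbd
      have hμ0 : 0 < ε * ‖μ‖ := by
        have := hno μ (Metric.mem_closedBall_self hs.le)
        rw [heμ, zero_sub, neg_ne_zero] at this
        have := norm_pos_iff.2 this
        rwa [norm_mul, Complex.norm_real, Real.norm_of_nonneg hε0.le] at this
      rw [inv_le_inv₀ hμ0 (by linarith)] at hbd
      nlinarith
    · rw [frontier_ball _ hs.ne'] at hz
      have hz1 : ‖z‖ < 1 := by simpa using hsub (Metric.sphere_subset_closedBall hz)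
      have hez : ‖e x‖ ≤ ‖e z‖ := hmin hz
      rw [norm_inv]
      refine inv_anti₀ (by linarith) ?_
      calc ‖e x‖ - ε ≤ ‖e z‖ - ‖(ε : ℂ) * z‖ := by
            rw [norm_mul, Complex.norm_real, Real.norm_of_nonneg hε0.le]
            nlinarith
        _ ≤ _ := norm_sub_norm_le _ _
  rw [← hf ε hε0 l (hsub hl) hl0]
  exact (Metric.mem_closedBall.1 hl).trans_lt hsε

/-- Continuity of f is not needed: the implicit function stays in U near z, so uniqueness of the
root identifies it with f. -/
lemma differentiableAt_of_unique_implicit {V : Type*} [NormedAddCommGroup V] [NormedSpace ℂ V]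
    [CompleteSpace V] {Φ : V × ℂ → ℂ} {z : V} {c : ℂ} (hΦ : ContDiffAt ℂ 1 Φ (z, c))
    (hd : deriv (fun l => Φ (z, l)) c ≠ 0) (h0 : Φ (z, c) = 0) {U : Set ℂ} (hU : U ∈ 𝓝 c)
    {f : V → ℂ} (hf : ∀ᶠ x in 𝓝 z, ∀ l ∈ U, Φ (x, l) = 0 → l = f x) :
    DifferentiableAt ℂ f z := by
  have hinv : (fderiv ℂ Φ (z, c) ∘L .inr ℂ V ℂ).IsInvertible := by
    refine ⟨ContinuousLinearEquiv.smulLeft (Units.mk0 _ hd), ?_⟩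
    ext
    have h1 : HasFDerivAt Φ (fderiv ℂ Φ (z, c)) (z, c) :=
      (hΦ.differentiableAt one_ne_zero).hasFDerivAt
    have h2 : HasDerivAt (fun l : ℂ => (z, l)) ((0 : V), (1 : ℂ)) c :=
      (hasDerivAt_const c z).prodMk (hasDerivAt_id c)
    have h3 := (h1.comp_hasDerivAt c h2).deriv
    change deriv (fun l => Φ (z, l)) c = _ at h3
    simp [Units.smul_def, h3]
  have hψd := (hΦ.hasStrictFDerivAt_implicitFunction one_ne_zero hinv).differentiableAt
  have hψ0 := hΦ.implicitFunction_apply_self one_ne_zero hinv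
  have hψU : ∀ᶠ x in 𝓝 z, hΦ.implicitFunction one_ne_zero hinv x ∈ U := by
    refine hψd.continuousAt.eventually_mem ?_
    rw [hψ0]
    exact hU
  refine hψd.congr_of_eventuallyEq ?_
  filter_upwards [hf, hψU, hΦ.eventually_apply_implicitFunction one_ne_zero hinv] with x h1 h2 h3
  exact (h1 _ h2 (h3.trans h0)).symm

/-! ### Schwarz–Pick and the Poincaré and Carathéodory distances -/

lemma Complex.normSq_one_sub_conj_mul_sub (b z : ℂ) :
    ‖1 - conj b * z‖ ^ 2 - ‖z - b‖ ^ 2 = (1 - ‖z‖ ^ 2) * (1 - ‖b‖ ^ 2) := by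
  simp only [Complex.sq_norm, Complex.normSq_apply]
  simp
  ring

lemma Complex.norm_sub_lt_norm_one_sub_conj_mul {b z : ℂ} (hb : ‖b‖ < 1) (hz : ‖z‖ < 1) :
    ‖z - b‖ < ‖1 - conj b * z‖ := by
  have h := Complex.normSq_one_sub_conj_mul_sub b z
  have h1 : 0 < 1 - ‖z‖ ^ 2 := by nlinarith [norm_nonneg z]
  have h2 : 0 < 1 - ‖b‖ ^ 2 := by nlinarith [norm_nonneg b]
  have := mul_pos h1 h2
  exact lt_of_pow_lt_pow_left₀ 2 (norm_nonneg _) (by linarith)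

lemma Complex.one_sub_conj_mul_ne_zero {b z : ℂ} (hb : ‖b‖ < 1) (hz : ‖z‖ < 1) :
    1 - conj b * z ≠ 0 :=
  norm_pos_iff.1 ((norm_nonneg _).trans_lt (Complex.norm_sub_lt_norm_one_sub_conj_mul hb hz))

lemma pseudohyperbolic_lt_one {l m : ℂ} (hl : ‖l‖ < 1) (hm : ‖m‖ < 1) :
    ‖l - m‖ / ‖1 - conj m * l‖ < 1 :=
  (div_lt_one (norm_pos_iff.2 (Complex.one_sub_conj_mul_ne_zero hm hl))).2
    (Complex.norm_sub_lt_norm_one_sub_conj_mul hm hl)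

/-- The **Schwarz–Pick lemma**. -/
theorem pseudohyperbolic_map_le {F : ℂ → ℂ} (hF : DifferentiableOn ℂ F (Metric.ball 0 1))
    (hmaps : MapsTo F (Metric.ball 0 1) (Metric.ball 0 1)) {l m : ℂ}
    (hl : l ∈ Metric.ball (0 : ℂ) 1) (hm : m ∈ Metric.ball (0 : ℂ) 1) :
    ‖F l - F m‖ / ‖1 - conj (F m) * F l‖ ≤ ‖l - m‖ / ‖1 - conj m * l‖ := by
  have hl1 : ‖l‖ < 1 := by simpa using hl
  have hm1 : ‖m‖ < 1 := by simpa using hm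
  have hFm : ‖F m‖ < 1 := by simpa using hmaps hm
  have hden : ∀ x ∈ Metric.ball (0 : ℂ) 1, 1 + conj m * x ≠ 0 := fun x hx => by
    have := Complex.one_sub_conj_mul_ne_zero (b := -m) (z := x) (by simpa) (by simpa using hx)
    simpa using this
  have hmob : MapsTo (fun x : ℂ => (x + m) / (1 + conj m * x)) (Metric.ball 0 1)
      (Metric.ball 0 1) := fun x hx => by
    have := pseudohyperbolic_lt_one (l := x) (m := -m) (by simpa using hx) (by simpa)
    simpa using this
  have hmobd : DifferentiableOn ℂ (fun x : ℂ => (x + m) / (1 + conj m * x)) (Metric.ball 0 1) :=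
    DifferentiableOn.div (by fun_prop) (by fun_prop) hden
  -- F is conjugated by disc automorphisms so that 0 ↦ 0, which reduces the claim to the Schwarz
  -- lemma.
  let G : ℂ → ℂ := fun x => (F ((x + m) / (1 + conj m * x)) - F m) /
    (1 - conj (F m) * F ((x + m) / (1 + conj m * x)))
  have hFd := hF.comp hmobd hmob
  have hG : DifferentiableOn ℂ G (Metric.ball 0 1) :=
    (hFd.sub_const (F m)).div ((differentiableOn_const 1).sub (hFd.const_mul _)) fun x hx =>
      Complex.one_sub_conj_mul_ne_zero hFm (by simpa using hmaps (hmob hx))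
  have hGm : MapsTo G (Metric.ball 0 1) (Metric.ball 0 1) := fun x hx => by
    have := pseudohyperbolic_lt_one (l := F ((x + m) / (1 + conj m * x))) (m := F m)
      (by simpa using hmaps (hmob hx)) hFm
    simpa [G] using this
  have hx : ‖(l - m) / (1 - conj m * l)‖ < 1 := by
    rw [norm_div]
    exact pseudohyperbolic_lt_one hl1 hm1
  have hxl : ((l - m) / (1 - conj m * l) + m) / (1 + conj m * ((l - m) / (1 - conj m * l))) = l := by
    have h1 : 1 - conj m * l ≠ 0 := Complex.one_sub_conj_mul_ne_zero hm1 hl1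
    rw [div_eq_iff (hden _ (by simpa using hx))]
    linear_combination div_mul_cancel₀ (l - m) h1
  have := Complex.norm_le_norm_of_mapsTo_ball hG
    (hGm.mono_right Metric.ball_subset_closedBall) (by simp [G]) hx
  rw [norm_div (l - m)] at this
  simpa only [G, hxl, norm_div] using this

lemma poincareDist_map_le {F : ℂ → ℂ} (hF : DifferentiableOn ℂ F (Metric.ball 0 1))
    (hmaps : MapsTo F (Metric.ball 0 1) (Metric.ball 0 1)) {l m : ℂ}
    (hl : l ∈ Metric.ball (0 : ℂ) 1) (hm : m ∈ Metric.ball (0 : ℂ) 1) :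
    poincareDist (F l) (F m) ≤ poincareDist l m :=
  Real.artanh_le_artanh (neg_one_lt_zero.trans_le (by positivity))
    (pseudohyperbolic_lt_one (by simpa using hl) (by simpa using hm))
    (pseudohyperbolic_map_le hF hmaps hl hm)

lemma continuousAt_artanh {x : ℝ} (hx : x ∈ Ioo (-1) 1) : ContinuousAt Real.artanh x := by
  have h1 : 0 < 1 + x := by linarith [hx.1]
  have h2 : 0 < 1 - x := by linarith [hx.2]
  unfold Real.artanh
  refine ContinuousAt.log ?_ (Real.sqrt_pos.2 (div_pos h1 h2)).ne'
  exact (ContinuousAt.div (by fun_prop) (by fun_prop) h2.ne').sqrt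

lemma tendsto_poincareDist {ι : Type*} {F : Filter ι} {f g : ι → ℂ} {l m : ℂ}
    (hl : l ∈ Metric.ball (0 : ℂ) 1) (hm : m ∈ Metric.ball (0 : ℂ) 1)
    (hf : Tendsto f F (𝓝 l)) (hg : Tendsto g F (𝓝 m)) :
    Tendsto (fun i => poincareDist (f i) (g i)) F (𝓝 (poincareDist l m)) := by
  have hl1 : ‖l‖ < 1 := by simpa using hl
  have hm1 : ‖m‖ < 1 := by simpa using hm
  refine (continuousAt_artanh (x := ‖l - m‖ / ‖1 - conj m * l‖)
    ⟨neg_one_lt_zero.trans_le (by positivity), pseudohyperbolic_lt_one hl1 hm1⟩).tendsto.comp ?_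
  refine (hf.sub hg).norm.div ?_ (norm_ne_zero_iff.2 (Complex.one_sub_conj_mul_ne_zero hm1 hl1))
  exact (tendsto_const_nhds.sub
    (((Complex.continuous_conj.tendsto m).comp hg).mul hf)).norm

lemma IsConvexTubeDomain.isOpen {n : ℕ} {D : Set (Fin n → ℂ)} (hD : IsConvexTubeDomain D) :
    IsOpen D := by
  obtain ⟨Ω, ho, -, -, rfl⟩ := hD
  exact ho.preimage (by fun_prop : Continuous fun z : Fin n → ℂ => fun j => (z j).re)

lemma caratheodoryDist_le_poincareDist {n : ℕ} {D : Set (Fin n → ℂ)} {φ : ℂ → Fin n → ℂ}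
    (hφ : IsHolomorphicDisc D φ) {l m : ℂ}
    (hl : l ∈ Metric.ball (0 : ℂ) 1) (hm : m ∈ Metric.ball (0 : ℂ) 1) :
    caratheodoryDist D (φ l) (φ m) ≤ ENNReal.ofReal (poincareDist l m) :=
  iSup_le fun f => ENNReal.ofReal_le_ofReal
    (poincareDist_map_le (f.2.1.comp hφ.1 hφ.2) (f.2.2.comp hφ.2) hl hm)

/-- Each f ε competes in the Carathéodory supremum, and its contribution tends to the Poincaré
distance; an exact left inverse is not required. -/
lemma isComplexGeodesic_of_approx_left_inverse {n : ℕ} {D : Set (Fin n → ℂ)}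
    {φ : ℂ → Fin n → ℂ} (hφ : IsHolomorphicDisc D φ) (f : ℝ → (Fin n → ℂ) → ℂ)
    (hf : ∀ ε, 0 < ε → DifferentiableOn ℂ (f ε) D ∧ MapsTo (f ε) D (Metric.ball 0 1))
    (hlim : ∀ l ∈ Metric.ball (0 : ℂ) 1, Tendsto (fun ε => f ε (φ l)) (𝓝[>] 0) (𝓝 l)) :
    IsComplexGeodesic D φ := by
  refine ⟨hφ, fun l hl m hm => le_antisymm (caratheodoryDist_le_poincareDist hφ hl hm) ?_⟩
  refine le_of_tendsto (ENNReal.tendsto_ofReal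
    (tendsto_poincareDist hl hm (hlim l hl) (hlim m hm))) ?_
  filter_upwards [self_mem_nhdsWithin] with ε hε
  exact le_iSup (fun F : {F : (Fin n → ℂ) → ℂ // DifferentiableOn ℂ F D ∧
    MapsTo F D (Metric.ball 0 1)} => ENNReal.ofReal (poincareDist (F.1 (φ l)) (F.1 (φ m))))
    ⟨f ε, hf ε hε⟩

/-! ### The Berkson–Porta splitting of h(λ) • (z - φ(λ)) -/

/-- The quadratic map `ā λ² + b λ + a`. -/
noncomputable def quadMap {n : ℕ} (a : Fin n → ℂ) (b : Fin n → ℝ) (l : ℂ) : Fin n → ℂ :=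
  fun j => conj (a j) * l ^ 2 + (b j : ℂ) * l + a j

/-- The holomorphic function `Q` with
`h(λ) • (z - φ(λ)) = α - ᾱ λ² + λ Q(λ)`, where `α = a • (z - φ(0))`. -/
noncomputable def generatorPart {n : ℕ} (a : Fin n → ℂ) (b : Fin n → ℝ) (φ : ℂ → Fin n → ℂ)
    (z : Fin n → ℂ) (l : ℂ) : ℂ :=
  2 * l * ∑ j, conj (a j) * ((z j - φ 0 j).re : ℂ) + ∑ j, (b j : ℂ) * (z j - φ 0 j)
    - quadMap a b l ⬝ᵥ dslope φ 0 l

section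

variable {n : ℕ} {a : Fin n → ℂ} {b : Fin n → ℝ} {φ : ℂ → Fin n → ℂ}

lemma differentiableOn_quadMap_dotProduct_dslope
    (hφ : DifferentiableOn ℂ φ (Metric.ball 0 1)) :
    DifferentiableOn ℂ (fun l => quadMap a b l ⬝ᵥ dslope φ 0 l) (Metric.ball 0 1) := by
  have hd := differentiableOn_pi.1 ((Complex.differentiableOn_dslope
    (Metric.isOpen_ball.mem_nhds (Metric.mem_ball_self one_pos))).2 hφ)
  simp only [dotProduct, quadMap]
  exact DifferentiableOn.fun_sum fun j _ => DifferentiableOn.mul (by fun_prop) (hd j)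

lemma differentiableOn_generatorPart (hφ : DifferentiableOn ℂ φ (Metric.ball 0 1))
    (z : Fin n → ℂ) : DifferentiableOn ℂ (generatorPart a b φ z) (Metric.ball 0 1) :=
  DifferentiableOn.sub (by fun_prop) (differentiableOn_quadMap_dotProduct_dslope hφ)

/-- The conjugate symmetry of the coefficients of h enters through ā_j u = 2ā_j Re u - conj(a_j u)
with u = z_j - φ_j(0), which produces the term -ᾱλ². -/
lemma quadMap_dotProduct_eq (z : Fin n → ℂ) (l : ℂ) :
    quadMap a b l ⬝ᵥ (z - φ l) = a ⬝ᵥ (z - φ 0) - conj (a ⬝ᵥ (z - φ 0)) * l ^ 2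
      + l * generatorPart a b φ z l := by
  have h1 : l • dslope φ 0 l = φ l - φ 0 := by
    simpa using sub_smul_dslope φ 0 l
  have h2 : l * (quadMap a b l ⬝ᵥ dslope φ 0 l) = quadMap a b l ⬝ᵥ (φ l - φ 0) := by
    rw [← h1, dotProduct_smul, smul_eq_mul]
  rw [generatorPart, mul_sub, h2]
  simp only [dotProduct, quadMap, Pi.sub_apply, map_sum, map_mul, map_sub, Finset.mul_sum,
    Finset.sum_mul, mul_add, ← Finset.sum_add_distrib, ← Finset.sum_sub_distrib]
  refine Finset.sum_congr rfl fun j _ => ?_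
  have h3 : (((z j - φ 0 j).re : ℝ) : ℂ) = ((z j - φ 0 j) + conj (z j - φ 0 j)) / 2 := by
    rw [Complex.add_conj]
    push_cast
    ring
  rw [h3, map_sub]
  ring

lemma re_quadMap_dotProduct_dslope_nonneg (hφ : DifferentiableOn ℂ φ (Metric.ball 0 1))
    (hii : ∀ l ∈ Metric.ball (0 : ℂ) 1, l ≠ 0 →
      (quadMap a b l ⬝ᵥ (l⁻¹ • (φ 0 - φ l))).re < 0)
    {l : ℂ} (hl : l ∈ Metric.ball (0 : ℂ) 1) : 0 ≤ (quadMap a b l ⬝ᵥ dslope φ 0 l).re := by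
  have hne : ∀ l ∈ Metric.ball (0 : ℂ) 1, l ≠ 0 → 0 ≤ (quadMap a b l ⬝ᵥ dslope φ 0 l).re := by
    intro l hl hl0
    have h1 := hii l hl hl0
    rw [dslope_of_ne _ hl0, slope_def_module, sub_zero]
    rw [← neg_sub, smul_neg, dotProduct_neg, Complex.neg_re] at h1
    linarith
  rcases eq_or_ne l 0 with rfl | hl0
  · have hb : Metric.ball (0 : ℂ) 1 ∈ 𝓝 0 := Metric.isOpen_ball.mem_nhds hl
    have hc := ((differentiableOn_quadMap_dotProduct_dslope (a := a) (b := b)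
      hφ).differentiableAt hb).continuousAt
    have ht := ((Complex.continuous_re.tendsto _).comp hc.tendsto).mono_left
      (nhdsWithin_le_nhds (s := {0}ᶜ))
    refine ge_of_tendsto ht ?_
    filter_upwards [self_mem_nhdsWithin, nhdsWithin_le_nhds hb] with x hx hx'
    exact hne x hx' hx
  · exact hne l hl hl0

lemma IsRadialLimit.tendsto_quadMap_dotProduct {ζ : ℂ} {w : Fin n → ℂ}
    (hw : IsRadialLimit φ ζ w) (z : Fin n → ℂ) :
    Tendsto (fun r : ℝ => quadMap a b (r * ζ) ⬝ᵥ (z - φ (r * ζ))) (𝓝[<] 1)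
      (𝓝 (quadMap a b ζ ⬝ᵥ (z - w))) := by
  have hq : Tendsto (fun r : ℝ => quadMap a b (r * ζ)) (𝓝[<] 1) (𝓝 (quadMap a b ζ)) := by
    have hc : Continuous fun r : ℝ => quadMap a b (r * ζ) := by
      unfold quadMap
      fun_prop
    have := (hc.tendsto 1).mono_left (nhdsWithin_le_nhds (s := Iio 1))
    simpa using this
  have hz := (tendsto_const_nhds (x := z)).sub hw
  exact tendsto_finsetSum _ fun j _ =>
    (tendsto_pi_nhds.1 hq j).mul (tendsto_pi_nhds.1 hz j)

/-- For |ζ| = 1 the number ζ̄(α - ᾱζ²) = ζ̄α - conj(ζ̄α) is purely imaginary, so the limit of Re Q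
is the quantity that condition (i) makes negative. -/
lemma exists_tendsto_generatorPart {ζ : ℂ} (hζ : ‖ζ‖ = 1) {w z : Fin n → ℂ}
    (hw : IsRadialLimit φ ζ w) (hneg : ((conj ζ • quadMap a b ζ) ⬝ᵥ (z - w)).re < 0) :
    ∃ c : ℂ, Tendsto (fun r : ℝ => generatorPart a b φ z (r * ζ)) (𝓝[<] 1) (𝓝 c) ∧
      c.re ≤ 0 := by
  have hζ0 : ζ ≠ 0 := fun h => by simp [h] at hζ
  have hinv : ζ⁻¹ = conj ζ := by
    rw [Complex.inv_def, Complex.normSq_eq_norm_sq, hζ]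
    simp
  set α := a ⬝ᵥ (z - φ 0)
  refine ⟨ζ⁻¹ * (quadMap a b ζ ⬝ᵥ (z - w) - (α - conj α * ζ ^ 2)), ?_, ?_⟩
  · have h1 : Tendsto (fun r : ℝ => (r : ℂ) * ζ) (𝓝[<] 1) (𝓝 ζ) := by
      have hc : Continuous fun r : ℝ => (r : ℂ) * ζ := by fun_prop
      have := (hc.tendsto 1).mono_left (nhdsWithin_le_nhds (s := Iio 1))
      simpa using this
    have h2 := (h1.inv₀ hζ0).mul ((hw.tendsto_quadMap_dotProduct (a := a) (b := b) z).sub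
      (((h1.pow 2).const_mul (conj α)).const_sub α))
    refine h2.congr' ?_
    have hpos : ∀ᶠ r : ℝ in 𝓝[<] 1, 0 < r := nhdsWithin_le_nhds (lt_mem_nhds one_pos)
    filter_upwards [hpos] with r hr
    have hr0 : (r : ℂ) * ζ ≠ 0 := mul_ne_zero (Complex.ofReal_ne_zero.2 hr.ne') hζ0
    rw [quadMap_dotProduct_eq, add_sub_cancel_left, inv_mul_cancel_left₀ hr0]
  · have h1 : ζ⁻¹ * (quadMap a b ζ ⬝ᵥ (z - w) - (α - conj α * ζ ^ 2))
        = (conj ζ • quadMap a b ζ) ⬝ᵥ (z - w) - (conj ζ * α - conj (conj ζ * α)) := by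
      rw [smul_dotProduct, smul_eq_mul, ← hinv, map_mul, hinv, Complex.conj_conj, ← hinv]
      field_simp
    rw [h1, Complex.sub_re, Complex.sub_re, Complex.conj_re, sub_self, sub_zero]
    exact hneg.le

lemma re_generatorPart_nonpos {D : Set (Fin n → ℂ)} (hφ : DifferentiableOn ℂ φ (Metric.ball 0 1))
    (hrad : ∀ᵐ t : ℝ ∂(volume.restrict (Ioc 0 (2 * Real.pi))),
      ∃ w, IsRadialLimit φ (circleMap 0 1 t) w ∧ ∀ z ∈ D,
        ((conj (circleMap 0 1 t) • quadMap a b (circleMap 0 1 t)) ⬝ᵥ (z - w)).re < 0)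
    (hii : ∀ l ∈ Metric.ball (0 : ℂ) 1, l ≠ 0 →
      (quadMap a b l ⬝ᵥ (l⁻¹ • (φ 0 - φ l))).re < 0)
    {z : Fin n → ℂ} (hz : z ∈ D) {l : ℂ} (hl : l ∈ Metric.ball (0 : ℂ) 1) :
    (generatorPart a b φ z l).re ≤ 0 := by
  -- Only the `dslope` term of Q can be unbounded, and condition (ii) gives it the favourable sign.
  refine re_nonpos_of_ae_radial (differentiableOn_generatorPart hφ z)
    (M := 2 * ‖∑ j, conj (a j) * ((z j - φ 0 j).re : ℂ)‖ + (∑ j, (b j : ℂ) * (z j - φ 0 j)).re)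
    (fun x hx => ?_) ?_ hl
  · have hx1 : ‖x‖ < 1 := by simpa using hx
    have h1 := re_quadMap_dotProduct_dslope_nonneg hφ hii hx
    rw [generatorPart, Complex.sub_re, Complex.add_re]
    have h2 := Complex.re_le_norm (2 * x * ∑ j, conj (a j) * ((z j - φ 0 j).re : ℂ))
    rw [norm_mul, norm_mul, Complex.norm_ofNat] at h2
    have h3 : 2 * ‖x‖ * ‖∑ j, conj (a j) * ((z j - φ 0 j).re : ℂ)‖
        ≤ 2 * ‖∑ j, conj (a j) * ((z j - φ 0 j).re : ℂ)‖ := by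
      refine mul_le_mul_of_nonneg_right ?_ (norm_nonneg _)
      linarith
    linarith
  · filter_upwards [hrad] with t ⟨w, hw, hneg⟩
    exact exists_tendsto_generatorPart (by simp) hw (hneg z hz)

lemma contDiffAt_quadMap_dotProduct (hφ : DifferentiableOn ℂ φ (Metric.ball 0 1)) {c : ℂ}
    (hc : c ∈ Metric.ball (0 : ℂ) 1) (z : Fin n → ℂ) (ε : ℝ) :
    ContDiffAt ℂ 1 (fun p : (Fin n → ℂ) × ℂ => quadMap a b p.2 ⬝ᵥ (p.1 - φ p.2) - ε * p.2)
      (z, c) := by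
  have hφc : ∀ j, ContDiffAt ℂ 1 (fun l => φ l j) c := fun j =>
    ((differentiableOn_pi.1 hφ j).analyticAt (Metric.isOpen_ball.mem_nhds hc)).contDiffAt
  have hφp : ∀ j, ContDiffAt ℂ 1 (fun p : (Fin n → ℂ) × ℂ => φ p.2 j) (z, c) := fun j =>
    ContDiffAt.comp (z, c) (g := fun l => φ l j) (hφc j) contDiffAt_snd
  simp only [dotProduct, quadMap, Pi.sub_apply]
  refine ContDiffAt.sub (ContDiffAt.sum fun j _ => ContDiffAt.mul ?_ (ContDiffAt.sub ?_ (hφp j))) ?_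
  · fun_prop
  · fun_prop
  · fun_prop

end

/-! ### The approximate left inverses and the conclusion -/

/-- In the boundary condition, `w` stands for the radial limit `φ*(l)`. That radial limits exist
almost everywhere is a consequence of the other hypotheses, so it is not assumed here. -/
theorem mainTheorem5 {n : ℕ} (D : Set (Fin n → ℂ)) (hD : IsConvexTubeDomain D)
    (hDtaut : IsTaut D) (φ : ℂ → Fin n → ℂ) (hφ : IsHolomorphicDisc D φ)
    (hex : ∃ h : ℂ → Fin n → ℂ,
      (∃ (a : Fin n → ℂ) (b : Fin n → ℝ), ∀ (l : ℂ) (j : Fin n),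
        h l j = conj (a j) * l ^ 2 + (b j : ℂ) * l + a j) ∧
      (∀ᵐ l ∂circleLebesgue, ∀ w : Fin n → ℂ, IsRadialLimit φ l w →
        ∀ z ∈ D, ((conj l • h l) ⬝ᵥ (z - w)).re < 0) ∧
      (∀ l ∈ Metric.ball (0 : ℂ) 1, l ≠ 0 → (h l ⬝ᵥ (l⁻¹ • (φ 0 - φ l))).re < 0)) :
    IsComplexGeodesic D φ := by
  obtain ⟨h, ⟨a, b, hab⟩, hi, hii⟩ := hex
  obtain rfl : h = quadMap a b := funext fun l => funext fun j => hab l j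
  have hrad : ∀ᵐ t : ℝ ∂(volume.restrict (Ioc 0 (2 * Real.pi))),
      ∃ w, IsRadialLimit φ (circleMap 0 1 t) w ∧ ∀ z ∈ D,
        ((conj (circleMap 0 1 t) • quadMap a b (circleMap 0 1 t)) ⬝ᵥ (z - w)).re < 0 := by
    filter_upwards [hφ.ae_exists_isRadialLimit hD hDtaut,
      ae_of_ae_map (continuous_circleMap 0 1).measurable.aemeasurable hi] with t ⟨w, hw⟩ ht
    exact ⟨w, hw, ht w hw⟩
  have hzero : ∀ ε : ℝ, 0 < ε → ∀ z ∈ D, ∃ c ∈ Metric.ball (0 : ℂ) 1,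
      quadMap a b c ⬝ᵥ (z - φ c) - ε * c = 0 ∧
      deriv (fun l => quadMap a b l ⬝ᵥ (z - φ l) - ε * l) c ≠ 0 ∧
      ∀ l ∈ Metric.ball (0 : ℂ) 1, quadMap a b l ⬝ᵥ (z - φ l) - ε * l = 0 → l = c := by
    intro ε hε z hz
    refine exists_unique_simple_zero (α := a ⬝ᵥ (z - φ 0)) (differentiableOn_generatorPart hφ.1 z)
      (fun l hl => re_generatorPart_nonpos hφ.1 hrad hii hz hl) hε
      (E := fun l => quadMap a b l ⬝ᵥ (z - φ l) - ε * l) fun l _ => ?_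
    rw [quadMap_dotProduct_eq]
    ring
  -- f ε z is the unique root of the perturbed equation.
  choose! f hfb hf0 hfd hfu using hzero
  refine isComplexGeodesic_of_approx_left_inverse hφ f (fun ε hε => ⟨fun z hz => ?_, hfb ε hε⟩)
    fun μ hμ => ?_
  · refine DifferentiableAt.differentiableWithinAt ?_
    refine differentiableAt_of_unique_implicit
      (contDiffAt_quadMap_dotProduct hφ.1 (hfb ε hε z hz) z ε) (hfd ε hε z hz) (hf0 ε hε z hz)
      (Metric.isOpen_ball.mem_nhds (hfb ε hε z hz)) ?_
    filter_upwards [hD.isOpen.mem_nhds hz] with x hx l hl hl0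
    exact hfu ε hε x hx l hl hl0
  · have hφμ := hφ.2 hμ
    refine tendsto_zero_of_perturbation (e := fun l => quadMap a b l ⬝ᵥ (φ μ - φ l)) ?_ hμ
      (by simp) ?_ fun ε hε l hl hl0 => hfu ε hε _ hφμ l hl hl0
    · simp only [quadMap_dotProduct_eq]
      have := differentiableOn_generatorPart (a := a) (b := b) hφ.1 (φ μ)
      fun_prop
    -- If h • (φ(μ) - φ) vanished identically, its radial limits would be 0, against the strict
    -- inequality in (i).
    · by_contra! hall
      have hne : (ae (volume.restrict (Ioc 0 (2 * Real.pi)))).NeBot := by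
        rw [ae_neBot, Ne, Measure.restrict_eq_zero, Real.volume_Ioc]
        simp [Real.pi_pos]
      obtain ⟨t, w, hw, hneg⟩ := hrad.exists
      have h1 := hw.tendsto_quadMap_dotProduct (a := a) (b := b) (φ μ)
      have h2 : quadMap a b (circleMap 0 1 t) ⬝ᵥ (φ μ - w) = 0 := by
        refine tendsto_nhds_unique h1 (tendsto_const_nhds.congr' ?_)
        have hpos : ∀ᶠ r : ℝ in 𝓝[<] 1, 0 < r := nhdsWithin_le_nhds (lt_mem_nhds one_pos)
        filter_upwards [hpos, self_mem_nhdsWithin] with r hr0 hr1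
        rw [← circleMap_zero_eq_mul]
        exact (hall _ (circleMap_mem_unitBall hr0 hr1 t)).symm
      have h3 := hneg _ hφμ
      rw [smul_dotProduct, h2, smul_zero, Complex.zero_re] at h3
      exact lt_irrefl _ h3
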